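/- Terminology. A $t$-$(m,q,k,1)$ group divisible design (GDD) $(\mathcal X,\mathcal G,\mathcal A)$ consists of a finite set $\mathcal X$ of points, a partition $\mathcal G$ of $\mathcal X$ into $m$ groups of size $q\ge 1$, and a family $\mathcal A$ of $k$-subsets of $\mathcal X$ (blocks), each meeting every group in at most one point, such that every $t$-set of points from $t$ distinct groups lies in exactly one block. For $s\ge 2$, an $s$-$(q,m,1)$ orthogonal array (OA) is a $q^s\times m$ array over a set of $q$ points such that within any $s$ columns every $s$-tuple of points occurs in exactly one row. For finite sets of cache-less users and of cache nodes, each user being allowed to access a given set of $L$ cache nodes (distinct users having distinct sets; these sets form the access topology), an $F$-division $(L,K,\Gamma,M,N)$ multiaccess device-to-device coded caching (MADCC) scheme, with $K$ users, $\Gamma$ cache nodes and $N\ge K$ files, works as follows. Each file is split into $F$ packets of equal size. Before the demands are known, each cache node stores uncoded packets amounting to exactly $M$ files, i.e. $MF$ packets. When each user has requested one file (demand vector $d$), each user $u$ broadcasts $S_{u,d}$ coded packets computed from the cache contents it can access, such that each user recovers each packet of its requested file from the cache contents it can access and at most one coded packet broadcast by another user (one-shot delivery). The load of the scheme is $R=\max_d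 \frac1F\sum_u S_{u,d}$. Theorem. Let $(\mathcal X,\mathcal G,\mathcal A)$ be a $t$-$(m,q,k,1)$ GDD, let $1\le t\le k\le s<m$, and suppose that an $s$-$(q,m,1)$ OA exists. Let the cache nodes be the points of $\mathcal X$ and the users the blocks in $\mathcal A$, the user $A\in\mathcal A$ accessing the cache nodes $x\in A$; thus $L=k$, $K=\binom mt q^t/\binom kt$, $\Gamma=mq$, and distinct users access distinct sets of cache nodes. Then for every $N\ge K$, for $M=N/q$ (which satisfies $M\ge \frac{N}{LK}$), for every $l$ with $1\le l\le\min(m-s,t-1)$ and for every packet size there is a $q^s\binom kl$-division $(k,K,mq,M,N)$ MADCC scheme with this access topology, hence with $\frac MN=\frac1q$, whose load satisfies $$R\le\frac{(q^m-q^s)\,q^{t-l}\binom{m-l}{t-l}}{q^s\binom kl\binom{k-l}{t-l}},$$ and moreover - if $k=t$, $s=m-1$ and $l=1$, then $R=\dfrac{(q-1)^t\binom{m-1}{t-1}}{t}$; - if $k=t$, $s=m-t+1>t$ and $l=m-s$, then $R=\dfrac{(q^{t-1}-1)(q-1)(m-t+1)}{t}$. -/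

import Mathlib

/-- `(Y, D)` is a `t-(v, r, lam)` orthogonal array: `D` has `lam * v ^ t` rows and `r` columns,
its entries are points of the `v`-set `Y`, and within any `t` columns every `t`-tuple of points
occurs in exactly `lam` rows. -/
structure IsOrthogonalArray {Y R : Type*} [Fintype Y] [DecidableEq Y] [Fintype R]
    (t v r lam : ℕ) (D : Matrix R (Fin r) Y) : Prop where
  two_le : 2 ≤ t
  le_cols : t ≤ r
  pos_points : 0 < v
  pos_index : 0 < lam
  card_points : Fintype.card Y = v
  card_rows : Fintype.card R = lam * v ^ t
  balanced : ∀ J : Finset (Fin r), J.card = t → ∀ y : J → Y,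
    (Finset.univ.filter fun i : R => ∀ j : J, D i j = y j).card = lam

/-- `(X, G, A)` is a `t-(m, q, k, lam)` group divisible design. The groups are the (nonempty)
parts of a partition `G` of the point set; the blocks form a finite family, indexed by `I`.
A set meeting every group in at most one point is a set of points from distinct groups. -/
structure IsGDD {X I : Type*} [Fintype X] [DecidableEq X] [Fintype I]
    (t m q k lam : ℕ) (G : Finpartition (Finset.univ : Finset X)) (A : I → Finset X) :
    Prop where
  pos_strength : 0 < t
  pos_block : 0 < k
  pos_index : 0 < lam
  card_groups : G.parts.card = m
  card_group : ∀ g ∈ G.parts, g.card = q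
  card_block : ∀ i, (A i).card = k
  block_inter : ∀ i, ∀ g ∈ G.parts, (A i ∩ g).card ≤ 1
  balanced : ∀ T : Finset X, T.card = t → (∀ g ∈ G.parts, (T ∩ g).card ≤ 1) →
    (Finset.univ.filter fun i : I => T ⊆ A i).card = lam

/-- A packet of `b` bits. -/
abbrev Packet (b : ℕ) : Type := Fin b → ZMod 2

/-- The contents of a library of `N` files, each split into `F` packets of `b` bits:
`W (n, f)` is the packet `f` of the file `n`. -/
abbrev Library (N F b : ℕ) : Type := Fin N × Fin F → Packet b

/-- The (labels of the) packets that user `u` finds in the cache nodes it can access. -/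
def accessible {U C : Type*} {N F : ℕ} (access : U → Finset C)
    (cache : C → Finset (Fin N × Fin F)) (u : U) : Set (Fin N × Fin F) :=
  {p | ∃ c ∈ access u, p ∈ cache c}

/-- An `F`-division multiaccess device-to-device coded caching scheme with cache-less users `U`,
cache nodes `C`, access topology `access`, cache memory `M` (in files), and `N` files of
`B = F * b` bits. -/
structure MADCCScheme {U C : Type*} (access : U → Finset C) (M : ℚ) (N F b : ℕ) where
  /-- Uncoded placement, made before the demands are known. -/
  cache : C → Finset (Fin N × Fin F)
  /-- Every cache node stores exactly `M` files' worth, that is, `M * F` packets. -/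
  card_cache : ∀ c, ((cache c).card : ℚ) = M * F
  /-- The number of coded packets that a user broadcasts for the demand vector `d`. -/
  numSent : (U → Fin N) → U → ℕ
  /-- The coded packets broadcast by `u`, as functions of the cache contents `u` can access. -/
  encode : ∀ (d : U → Fin N) (u : U),
    (accessible access cache u → Packet b) → Fin (numSent d u) → Packet b
  /-- One-shot delivery: each user recovers each packet of its requested file from the cache
  contents it can access and at most one transmission of another user. -/
  recover : ∀ (d : U → Fin N) (u : U) (f : Fin F),
    (∃ g : (accessible access cache u → Packet b) → Packet b,
      ∀ W : Library N F b, g (fun p => W p) = W (d u, f)) ∨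
    (∃ u' : U, u' ≠ u ∧ ∃ i : Fin (numSent d u'),
      ∃ g : (accessible access cache u → Packet b) → Packet b → Packet b,
        ∀ W : Library N F b,
          g (fun p => W p) (encode d u' (fun p => W p) i) = W (d u, f))

/-- The transmission load, normalized to the file size, in the worst case over the demands. -/
def MADCCScheme.load {U C : Type*} [Fintype U] [DecidableEq U] {access : U → Finset C}
    {M : ℚ} {N F b : ℕ} (S : MADCCScheme access M N F b) : ℚ :=
  ((Finset.univ.sup fun d : U → Fin N => ∑ u, S.numSent d u : ℕ) : ℚ) / F

/-!
Give every point of the design coordinates (group, label) in `Fin m × Y`, so that a word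
`v : Fin m → Y` becomes a transversal of the groups: it passes through one point of each. The rows
of the orthogonal array are `q ^ s` transversals, two of which agree in fewer than `s` groups.

*Placement.* A packet of a file is labelled by a row `r` and an index in `Fin (k.choose l)`, which
every block reads, through its own bijection, as an `l`-subset of itself. The node `x` stores the
packets whose row passes through `x`. A block therefore misses exactly the packets whose row
avoids it.

*Delivery.* Suppose the block `B` misses the packet of the row `r` and the `l`-subset `S` of `B`.
Reroute `r` through the points of `S`: the transversal `v` obtained meets `B` in `S` exactly
(`trace_reroute`), and it is not a row because it differs from `r` in `l ≤ m - s` groups. For the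
same reason `v` and `S` determine `r`. Two packets with the same `v` and different sets `S ≠ S'`
can be added up: `v` passes through a point of `S \ S'`, where it agrees with the row belonging to
`S'`, so the block wanting the packet of `S` has the one of `S'`. The blocks with the same `v` and
the same `S` are kept apart by a second index in `Fin ν`, where `ν` bounds the number of blocks
that meet a transversal in a given `l`-set. A block which meets `v` in more than `l` points has all
these packets and can send their sum; it exists since the `t > l` points of `v` in any `t` groups
lie in a block. There are `q ^ m - q ^ s` transversals that are not rows, whence
`(q ^ m - q ^ s) * ν` transmissions (`exists_scheme_of_card_trace_le`).

*The value of `ν`.* In general the number of blocks through an `l`-set will do, by double counting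
(`card_blocks_superset_mul`). If `k = t`, only the blocks avoiding `v` outside the `l`-set count,
at most `(m - l).choose (t - l) * (q - 1) ^ (t - l)` of them (`card_trace_eq_le`); this gives the
two exact loads.
-/

/-! ### Multicast delivery -/

open Finset in
/-- Multicast delivery with coded packets that are sums of uncoded ones. The nodes store the same
packets `store c` of every file. Each request `p`, of a user `p.1.1` for a packet `p.1.2` missing
from its nodes, is assigned to a message `msg p` of the user `sender (msg p)`, and a message is
the sum of the packets assigned to it. It can be formed if the sender has them all, and decoded
if each receiver has all but its own. -/
theorem exists_scheme_of_multicast {U C τ : Type*} [Fintype U] [DecidableEq U] [Fintype τ]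
    {access : U → Finset C} {M : ℚ} {N F b : ℕ} (hN : 0 < N)
    (store : C → Finset (Fin F)) (hstore : ∀ c, (N : ℚ) * ((store c).card : ℚ) = M * F)
    (sender : τ → U)
    (msg : {p : U × Fin F // ¬ ∃ c ∈ access p.1, p.2 ∈ store c} → τ)
    (sender_ne : ∀ p, sender (msg p) ≠ p.1.1)
    (sender_knows : ∀ p, ∃ c ∈ access (sender (msg p)), p.1.2 ∈ store c)
    (receiver_knows : ∀ p p', msg p = msg p' → p ≠ p' → ∃ c ∈ access p.1.1, p'.1.2 ∈ store c) :
    ∃ S : MADCCScheme access M N F b, S.load = (Fintype.card τ : ℚ) / F := by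
  classical
  let cache : C → Finset (Fin N × Fin F) := fun c => univ ×ˢ store c
  have mem_acc : ∀ u n f, (n, f) ∈ accessible access cache u ↔
      ∃ c ∈ access u, f ∈ store c := by
    intro u n f; simp [accessible, cache]
  -- a user's view of a packet, set to `0` if the packet is not accessible
  let look : ∀ u, (accessible access cache u → Packet b) → Fin N × Fin F → Packet b :=
    fun u c p => if h : p ∈ accessible access cache u then c ⟨p, h⟩ else 0
  have look_eq : ∀ u (W : Library N F b) p, p ∈ accessible access cache u →
      look u (fun p => W p) p = W p := by
    intro u W p hp; simp [look, hp]
  let numSent : U → ℕ := fun u => Fintype.card {a : τ // sender a = u}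
  let enum : ∀ u, Fin (numSent u) ≃ {a : τ // sender a = u} := fun u => (Fintype.equivFin _).symm
  let S : MADCCScheme access M N F b :=
    { cache := cache
      card_cache := by
        intro c
        simp only [cache, card_product, card_univ, Fintype.card_fin]
        push_cast
        exact hstore c
      numSent := fun _ u => numSent u
      encode := fun d u c i =>
        ∑ p with msg p = (enum u i).1, look u c (d p.1.1, p.1.2)
      recover := by
        intro d u f
        by_cases hk : ∃ c ∈ access u, f ∈ store c
        · left
          exact ⟨fun c => look u c (d u, f), fun W => look_eq u W _ ((mem_acc u _ f).2 hk)⟩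
        · right
          let p₀ : {p : U × Fin F // ¬ ∃ c ∈ access p.1, p.2 ∈ store c} := ⟨(u, f), hk⟩
          refine ⟨sender (msg p₀), sender_ne p₀, (enum _).symm ⟨msg p₀, rfl⟩,
            fun c y => y - ∑ p ∈ ({p | msg p = msg p₀} : Finset _).erase p₀,
              look u c (d p.1.1, p.1.2), fun W => ?_⟩
          have h1 : ∀ p ∈ ({p | msg p = msg p₀} : Finset _),
              look (sender (msg p₀)) (fun p => W p) (d p.1.1, p.1.2) = W (d p.1.1, p.1.2) := by
            intro p hp
            rw [mem_filter] at hp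
            exact look_eq _ W _ ((mem_acc _ _ _).2 (hp.2 ▸ sender_knows p))
          have h2 : ∀ p ∈ ({p | msg p = msg p₀} : Finset _).erase p₀,
              look u (fun p => W p) (d p.1.1, p.1.2) = W (d p.1.1, p.1.2) := by
            intro p hp
            rw [mem_erase, mem_filter] at hp
            exact look_eq _ W _ ((mem_acc _ _ _).2 (receiver_knows p₀ p hp.2.2.symm hp.1.symm))
          simp only [Equiv.apply_symm_apply]
          rw [sum_congr rfl h1, sum_congr rfl h2, sub_eq_iff_eq_add]
          exact (add_sum_erase _ (fun p => W (d p.1.1, p.1.2))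
            (by simp : p₀ ∈ ({p | msg p = msg p₀} : Finset _))).symm }
  refine ⟨S, ?_⟩
  have hsum : ∑ u, numSent u = Fintype.card τ := by
    rw [← Fintype.card_sigma]
    exact Fintype.card_congr (Equiv.sigmaFiberEquiv sender)
  have : Nonempty (Fin N) := ⟨⟨0, hN⟩⟩
  unfold MADCCScheme.load
  change ((univ.sup fun _ : U → Fin N => ∑ u, numSent u : ℕ) : ℚ) / F = _
  rw [sup_const univ_nonempty, hsum]

/-! ### Counting partial transversals -/

open Finset in
/-- The number of `n`-subsets of `Z` on which `f` is injective, if `f` maps `Z` to `H` with fibres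
of size `c`. Injectivity is expressed by the (decidable) condition that the image of the set is no
smaller than the set. -/
theorem card_transversals {X ι : Type*} [DecidableEq X] [DecidableEq ι] (f : X → ι)
    (Z : Finset X) (H : Finset ι) (c : ℕ) (hZ : ∀ x ∈ Z, f x ∈ H)
    (hc : ∀ j ∈ H, (Z.filter fun x => f x = j).card = c) (n : ℕ) :
    ((Z.powersetCard n).filter fun T => T.card ≤ (T.image f).card).card = H.card.choose n * c ^ n := by
  have hfib : ((powersetCard n H).sigma fun J => J.pi fun j => Z.filter fun x => f x = j).card =
      H.card.choose n * c ^ n := by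
    rw [card_sigma, ← card_powersetCard n H, ← smul_eq_mul]
    apply sum_eq_card_nsmul
    intro J hJ
    rw [mem_powersetCard] at hJ
    rw [card_pi, prod_congr rfl fun j hj => hc j (hJ.1 hj), prod_const, hJ.2]
  rw [← hfib]
  symm
  -- a choice of one point in the fibre over each `j ∈ J` gives a set with image `J`
  have key : ∀ (J : Finset ι) (g : ∀ j ∈ J, X), g ∈ (J.pi fun j => Z.filter fun x => f x = j) →
      (J.attach.image fun j => g j.1 j.2).image f = J ∧
      (J.attach.image fun j => g j.1 j.2).card = J.card := by
    intro J g hg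
    simp only [mem_pi, mem_filter] at hg
    have h1 : (J.attach.image fun j => g j.1 j.2).image f = J := by
      ext j
      simp only [mem_image, mem_attach, true_and, Subtype.exists]
      constructor
      · rintro ⟨_, ⟨j', hj', rfl⟩, rfl⟩
        rwa [(hg j' hj').2]
      · intro hj
        exact ⟨_, ⟨j, hj, rfl⟩, (hg j hj).2⟩
    refine ⟨h1, ?_⟩
    refine le_antisymm (card_image_le.trans_eq (by simp)) ?_
    conv_lhs => rw [← h1]
    exact card_image_le
  refine card_bij (fun p _ => p.1.attach.image fun j => p.2 j.1 j.2) ?_ ?_ ?_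
  · rintro ⟨J, g⟩ hp
    rw [mem_sigma] at hp
    obtain ⟨hJ, hg⟩ := hp
    dsimp only at hJ hg ⊢
    have hk := key J g hg
    simp only [mem_pi, mem_filter] at hg
    rw [mem_powersetCard] at hJ
    rw [mem_filter, mem_powersetCard, hk.1, hk.2]
    refine ⟨⟨?_, hJ.2⟩, le_rfl⟩
    intro x hx
    simp only [mem_image, mem_attach, true_and, Subtype.exists] at hx
    obtain ⟨j, hj, rfl⟩ := hx
    exact (hg j hj).1
  · rintro ⟨J, g⟩ hp ⟨J', g'⟩ hp' h
    rw [mem_sigma] at hp hp'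
    dsimp only at hp hp' h
    have hJ : J = J' := by rw [← (key J g hp.2).1, ← (key J' g' hp'.2).1, h]
    subst hJ
    congr 1
    have hg := hp.2
    have hg' := hp'.2
    simp only [mem_pi, mem_filter] at hg hg'
    funext j hj
    have : g j hj ∈ J.attach.image fun j => g' j.1 j.2 := by
      rw [← h]; exact mem_image.2 ⟨⟨j, hj⟩, mem_attach _ _, rfl⟩
    simp only [mem_image, mem_attach, true_and, Subtype.exists] at this
    obtain ⟨i, hi, hij⟩ := this
    have : i = j := by rw [← (hg' i hi).2, hij, (hg j hj).2]
    subst this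
    exact hij.symm
  · intro T hT
    rw [mem_filter, mem_powersetCard] at hT
    obtain ⟨⟨hTZ, hTn⟩, hTc⟩ := hT
    have hinj : Set.InjOn f T := card_image_iff.1 (le_antisymm card_image_le hTc)
    have hex : ∀ j ∈ T.image f, ∃ x ∈ T, f x = j := fun j hj => mem_image.1 hj
    choose g hgT hgf using hex
    refine ⟨⟨T.image f, g⟩, ?_, ?_⟩
    · rw [mem_sigma, mem_powersetCard]
      refine ⟨⟨?_, (card_image_of_injOn hinj).trans hTn⟩, ?_⟩
      · intro j hj
        obtain ⟨x, hx, rfl⟩ := mem_image.1 hj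
        exact hZ x (hTZ hx)
      · simp only [mem_pi, mem_filter]
        exact fun j hj => ⟨hTZ (hgT j hj), hgf j hj⟩
    · ext x
      simp only [mem_image, mem_attach, true_and, Subtype.exists]
      constructor
      · rintro ⟨j, hj, rfl⟩
        exact hgT j (mem_image.2 hj)
      · intro hx
        exact ⟨f x, ⟨x, hx, rfl⟩, hinj (hgT _ _) hx (hgf _ _)⟩

/-! ### Orthogonal arrays of index one -/

open Finset in
/-- Rows agreeing in `s` columns are equal. -/
theorem IsOrthogonalArray.row_injective {Y R : Type*} [Fintype Y] [DecidableEq Y] [Fintype R]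
    {s q m : ℕ} {D : Matrix R (Fin m) Y} (h : IsOrthogonalArray s q m 1 D) {J : Finset (Fin m)}
    (hJ : s ≤ J.card) {r r' : R} (hr : ∀ j ∈ J, D r j = D r' j) : r = r' := by
  obtain ⟨J', hJ', hcard⟩ := exists_subset_card_eq hJ
  obtain ⟨a, ha⟩ := card_eq_one.1 (h.balanced J' hcard fun j => D r' j)
  have h1 : r ∈ ({a} : Finset R) := by
    rw [← ha]; simpa using fun j hj => hr j (hJ' hj)
  have h2 : r' ∈ ({a} : Finset R) := by
    rw [← ha]; simp
  rw [mem_singleton] at h1 h2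
  rw [h1, h2]

open Finset in
/-- Every point occurs `q ^ (s - 1)` times in each column: restricted to `s` columns, one of them
the given one, the rows are all words. -/
theorem IsOrthogonalArray.card_column_mul {Y R : Type*} [Fintype Y] [DecidableEq Y] [Fintype R]
    {s q m : ℕ} {D : Matrix R (Fin m) Y} (h : IsOrthogonalArray s q m 1 D) (j : Fin m) (y : Y) :
    (univ.filter fun r => D r j = y).card * q = q ^ s := by
  obtain ⟨J, hjJ, -, hJ⟩ := exists_subsuperset_card_eq (subset_univ ({j} : Finset (Fin m)))
    (n := s) (by have := h.two_le; simp; omega) (by simpa using h.le_cols)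
  have hj : j ∈ J := hjJ (mem_singleton_self j)
  have hbij : Function.Bijective fun (r : R) (i : J) => D r i := by
    rw [Fintype.bijective_iff_injective_and_card]
    constructor
    · intro r r' hr
      exact h.row_injective hJ.ge fun i hi => congrFun hr ⟨i, hi⟩
    · simp [h.card_rows, h.card_points, hJ]
  have : (univ.filter fun r => D r j = y).card =
      ((Fintype.piFinset fun _ : J => (univ : Finset Y)).filter fun g => g ⟨j, hj⟩ = y).card := by
    refine card_bij (fun r _ i => D r i) ?_ ?_ ?_
    · intro r hr; simpa using hr
    · intro r _ r' _ e; exact hbij.1 e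
    · intro g hg
      obtain ⟨r, rfl⟩ := hbij.2 g
      exact ⟨r, by simpa using hg, rfl⟩
  rw [this, Fintype.card_filter_piFinset_const_eq_of_mem _ _ (mem_univ y)]
  have hs := h.two_le
  simp only [card_univ, h.card_points, Fintype.card_coe, hJ]
  rw [← pow_succ]
  congr 1
  omega

/-! ### Coordinates -/

open Finset in
/-- Coordinates (group, label in the group) on the points of a partition into `m` groups of
equal size. -/
theorem Finpartition.exists_coordinates {X Y : Type*} [Fintype X] [DecidableEq X] [Fintype Y]
    {m : ℕ} (G : Finpartition (univ : Finset X)) (hm : G.parts.card = m)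
    (hq : ∀ g ∈ G.parts, g.card = Fintype.card Y) :
    ∃ pos : X ≃ Fin m × Y, ∀ T : Finset X,
      (∀ g ∈ G.parts, (T ∩ g).card ≤ 1) ↔ Set.InjOn (fun x => (pos x).1) T := by
  classical
  let ε : G.parts ≃ Fin m := Fintype.equivFinOfCardEq (by simpa using hm)
  let part : X → G.parts := fun x => ⟨G.part x, G.part_mem.2 (mem_univ x)⟩
  let φ : ∀ g : G.parts, g.1 ≃ Y := fun g => Fintype.equivOfCardEq (by simpa using hq g.1 g.2)
  have hmem : ∀ x, x ∈ (part x).1 := fun x => G.mem_part (mem_univ x)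
  let p : X → Fin m × Y := fun x => (ε (part x), φ (part x) ⟨x, hmem x⟩)
  have hp : Function.Bijective p := by
    constructor
    · intro x y hxy
      have h1 : part x = part y := ε.injective (congrArg Prod.fst hxy)
      have h2 : ∀ g g' (hg : g = g') (hx : x ∈ g.1) (hy : y ∈ g'.1),
          φ g ⟨x, hx⟩ = φ g' ⟨y, hy⟩ → x = y := by
        rintro g _ rfl hx hy he
        exact congrArg Subtype.val ((φ g).injective he)
      exact h2 _ _ h1 _ _ (congrArg Prod.snd hxy)
    · rintro ⟨j, y⟩
      obtain ⟨g, rfl⟩ := ε.surjective j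
      obtain ⟨⟨x, hx⟩, rfl⟩ := (φ g).surjective y
      have hg : part x = g := Subtype.ext (G.part_eq_of_mem g.2 hx)
      subst hg
      exact ⟨x, rfl⟩
  refine ⟨Equiv.ofBijective p hp, fun T => ⟨fun h x hx y hy hxy => ?_, fun h g hg => ?_⟩⟩
  · have h1 : part x = part y := ε.injective hxy
    exact card_le_one.1 (h _ (part x).2) x (mem_inter.2 ⟨hx, hmem x⟩) y
      (mem_inter.2 ⟨hy, h1 ▸ hmem y⟩)
  · refine card_le_one.2 fun x hx y hy => ?_
    rw [mem_inter] at hx hy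
    refine h hx.1 hy.1 (congrArg ε (Subtype.ext ?_))
    exact (G.part_eq_of_mem hg hx.2).trans (G.part_eq_of_mem hg hy.2).symm

/-! ### Rerouting a transversal -/

/-- The points of `B` lying on the transversal `v`, the one that meets the group `j` in the point
`pos.symm (j, v j)`. -/
def trace {X Y ι : Type*} [DecidableEq Y] (pos : X ≃ ι × Y) (B : Finset X) (v : ι → Y) :
    Finset X :=
  B.filter fun x => v (pos x).1 = (pos x).2

open Classical in
/-- The transversal `v` rerouted through the points of `S`: in the groups met by `S` it takes the
point of `S`, elsewhere it is `v`. If `S` has several points in a group, one of them is chosen. -/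
noncomputable def reroute {X Y ι : Type*} (pos : X ≃ ι × Y) (v : ι → Y) (S : Finset X) : ι → Y :=
  fun j => if h : ∃ x ∈ S, (pos x).1 = j then (pos h.choose).2 else v j

section Transversal

variable {X Y ι : Type*} {pos : X ≃ ι × Y}

theorem reroute_of_mem {v : ι → Y} {S : Finset X}
    (hS : Set.InjOn (fun x => (pos x).1) S) {x : X} (hx : x ∈ S) :
    reroute pos v S (pos x).1 = (pos x).2 := by
  have h : ∃ y ∈ S, (pos y).1 = (pos x).1 := ⟨x, hx, rfl⟩
  rw [reroute, dif_pos h, hS h.choose_spec.1 hx h.choose_spec.2]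

theorem reroute_of_forall_ne {v : ι → Y} {S : Finset X} {j : ι}
    (hj : ∀ x ∈ S, (pos x).1 ≠ j) : reroute pos v S j = v j := by
  rw [reroute, dif_neg]
  rintro ⟨x, hx, h⟩
  exact hj x hx h

/-- A point of the rerouted transversal outside `S` lies on `v`, even if it is in a group that `S`
meets, since there the rerouted transversal passes through a point of `S`. -/
theorem eq_of_reroute_eq {v : ι → Y} {S : Finset X} (hS : Set.InjOn (fun x => (pos x).1) S)
    {x : X} (hx : reroute pos v S (pos x).1 = (pos x).2) (hxS : x ∉ S) :
    v (pos x).1 = (pos x).2 := by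
  by_cases h : ∃ y ∈ S, (pos y).1 = (pos x).1
  · obtain ⟨y, hy, hyx⟩ := h
    rw [← hyx, reroute_of_mem hS hy] at hx
    exact absurd (pos.injective (Prod.ext hyx hx) ▸ hy) hxS
  · rw [← hx, reroute_of_forall_ne fun y hy e => h ⟨y, hy, e⟩]

/-- If a block avoids `v`, then rerouting `v` through a subset of the block makes it meet the block
in exactly that subset. -/
theorem trace_reroute [DecidableEq Y] {v : ι → Y} {B S : Finset X} (hSB : S ⊆ B)
    (hB : Set.InjOn (fun x => (pos x).1) B) (hv : ∀ x ∈ B, v (pos x).1 ≠ (pos x).2) :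
    trace pos B (reroute pos v S) = S := by
  have hS : Set.InjOn (fun x => (pos x).1) S := hB.mono (by exact_mod_cast hSB)
  ext x
  rw [trace, Finset.mem_filter]
  constructor
  · rintro ⟨hx, hxv⟩
    by_contra hxS
    exact hv x hx (eq_of_reroute_eq hS hxv hxS)
  · exact fun hx => ⟨hSB hx, reroute_of_mem hS hx⟩

end Transversal

/-! ### The scheme -/

open Finset in
/-- The scheme with a message for every transversal `v` that is not a row of the array and every
index in `Fin ν`, when `ν` bounds the number of blocks meeting a transversal in a given `l`-set and
every transversal is met by some block in more than `l` points. The load is exact because each of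
these messages is counted, those to which no request is assigned (empty sums) included. -/
theorem exists_scheme_of_card_trace_le {X I Y R : Type*} [Fintype X] [Fintype I]
    [DecidableEq I] [Fintype Y] [DecidableEq Y] [Fintype R] {m q k s l ν N b : ℕ} {M : ℚ}
    (pos : X ≃ Fin m × Y) (A : I → Finset X) (hA : ∀ i, (A i).card = k)
    (hpos : ∀ i, Set.InjOn (fun x => (pos x).1) (A i))
    (D : Matrix R (Fin m) Y) (hD : IsOrthogonalArray s q m 1 D)
    (hl : 1 ≤ l) (hls : l + s ≤ m)
    (hν : ∀ v (S : Finset X), S.card = l →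
      Nat.card {i // trace pos (A i) v = S} ≤ ν)
    (hsend : ∀ v, ∃ i, l < (trace pos (A i) v).card) (hN : 0 < N) (hM : M * q = N) :
    ∃ S : MADCCScheme A M N (q ^ s * k.choose l) b,
      S.load = ((q : ℚ) ^ m - q ^ s) * ν / (q ^ s * k.choose l) := by
  classical
  have hq := hD.pos_points
  have hrow : Function.Injective fun r => D r := fun r r' h =>
    hD.row_injective (J := univ) (by simpa using hD.le_cols) fun j _ => congrFun h j
  let pkt : Fin (q ^ s * k.choose l) ≃ R × Fin (k.choose l) :=
    (Fintype.equivFinOfCardEq (by simp [hD.card_rows])).symm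
  let sub : ∀ i, Fin (k.choose l) ≃ {S // S ∈ (A i).powersetCard l} := fun i =>
    (Fintype.equivFinOfCardEq (by rw [Fintype.card_coe, card_powersetCard, hA])).symm
  have hsub : ∀ i κ, ((sub i κ).1 ⊆ A i) ∧ (sub i κ).1.card = l := fun i κ =>
    mem_powersetCard.1 (sub i κ).2
  let store : X → Finset (Fin (q ^ s * k.choose l)) := fun x =>
    univ.filter fun f => D (pkt f).1 (pos x).1 = (pos x).2
  have mem_store : ∀ x f, f ∈ store x ↔ D (pkt f).1 (pos x).1 = (pos x).2 := by
    intro x f; simp [store]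
  have hstore : ∀ x, (store x).card * q = q ^ s * k.choose l := by
    intro x
    have : (store x).card =
        ((univ.filter fun r => D r (pos x).1 = (pos x).2) ×ˢ
          (univ : Finset (Fin (k.choose l)))).card :=
      card_equiv pkt fun f => by simp [store]
    rw [this, card_product, card_univ, Fintype.card_fin, mul_right_comm, hD.card_column_mul]
  -- a request: the user `i` misses the packet `f`
  let Req := {p : I × Fin (q ^ s * k.choose l) // ¬ ∃ x ∈ A p.1, p.2 ∈ store x}
  let T : Req → Finset X := fun p => (sub p.1.1 (pkt p.1.2).2).1
  let row : Req → R := fun p => (pkt p.1.2).1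
  let V : Req → Fin m → Y := fun p => reroute pos (D (row p)) (T p)
  have hT : ∀ p, (T p).card = l := fun p => (hsub _ _).2
  have hTA : ∀ p, T p ⊆ A p.1.1 := fun p => (hsub _ _).1
  have hTi : ∀ p, Set.InjOn (fun x => (pos x).1) (T p : Set X) := fun p =>
    (hpos p.1.1).mono (by exact_mod_cast hTA p)
  have hmiss : ∀ p : Req, ∀ x ∈ A p.1.1, D (row p) (pos x).1 ≠ (pos x).2 := fun p x hx h =>
    p.2 ⟨x, hx, (mem_store _ _).2 h⟩
  have htrace : ∀ p, trace pos (A p.1.1) (V p) = T p := fun p =>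
    trace_reroute (hTA p) (hpos _) (hmiss p)
  -- a transversal differing from a row in at most `l ≤ m - s` groups determines that row
  have hrow_eq : ∀ (p : Req) r, (∀ j, (∀ x ∈ T p, (pos x).1 ≠ j) → V p j = D r j) →
      row p = r := by
    intro p r h
    refine hD.row_injective (J := univ \ (T p).image fun x => (pos x).1) ?_ fun j hj => ?_
    · rw [card_sdiff_of_subset (subset_univ _), card_image_of_injOn (hTi p), hT]
      simp only [card_univ, Fintype.card_fin]; omega
    · have hj' : ∀ x ∈ T p, (pos x).1 ≠ j := fun x hx e =>
        (mem_sdiff.1 hj).2 (mem_image.2 ⟨x, hx, e⟩)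
      rw [← h j hj']
      exact (reroute_of_forall_ne hj').symm
  have hnot : ∀ p, V p ∉ univ.image fun r => D r := by
    intro p hp
    obtain ⟨r, -, hr⟩ := mem_image.1 hp
    have hr' := hrow_eq p r fun j _ => (congrFun hr j).symm
    obtain ⟨x, hx⟩ := card_pos.1 (hl.trans_eq (hT p).symm)
    refine hmiss p x (hTA p hx) ?_
    rw [hr', ← reroute_of_mem (v := D (row p)) (hTi p) hx]
    exact congrFun hr _
  have hemb : ∀ v S, S.card = l → Nonempty ({i // trace pos (A i) v = S} ↪ Fin ν) := by
    intro v S hS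
    have := hν v S hS
    rw [Nat.card_eq_fintype_card] at this
    exact Function.Embedding.nonempty_of_card_le (by simpa using this)
  have emb := fun v S hS => Classical.choice (hemb v S hS)
  choose sender hsender using hsend
  -- a block meeting the rerouted transversal outside `T p` meets the row itself
  have hknow : ∀ (p : Req) (i : I) (x : X), x ∈ trace pos (A i) (V p) → x ∉ T p →
      ∃ c ∈ A i, p.1.2 ∈ store c := by
    intro p i x hx hxT
    rw [trace, mem_filter] at hx
    exact ⟨x, hx.1, (mem_store _ _).2 (eq_of_reroute_eq (hTi p) hx.2 hxT)⟩
  obtain ⟨S, hS⟩ := exists_scheme_of_multicast (access := A) (M := M) (b := b)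
    (τ := {v : Fin m → Y // v ∉ univ.image fun r => D r} × Fin ν) hN store
    (by
      intro x
      have h := hstore x
      have h' : ((store x).card : ℚ) * q = (q ^ s * k.choose l : ℕ) := by exact_mod_cast h
      rw [← hM, ← h']; ring)
    (fun a => sender a.1.1)
    (fun p => (⟨V p, hnot p⟩, emb (V p) (T p) (hT p) ⟨p.1.1, htrace p⟩))
    (by
      intro p h
      have := hsender (V p)
      dsimp only at h
      rw [h, htrace, hT] at this
      exact lt_irrefl _ this)
    (by
      intro p
      obtain ⟨x, hx, hxT⟩ := exists_mem_notMem_of_card_lt_card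
        ((hT p).trans_lt (hsender (V p)))
      exact hknow p _ x hx hxT)
    (by
      intro p p' h hne
      have hV : V p = V p' := congrArg (fun a => a.1.1) h
      have hE := congrArg Prod.snd h
      dsimp only at hE
      -- as both sets have `l` elements, `T p ⊆ T p'` forces the requests to coincide
      by_cases hTT : T p ⊆ T p'
      · exfalso
        have hTT' : T p = T p' := eq_of_subset_of_card_le hTT (by rw [hT, hT])
        have hE' : ∀ v v' S S' (hS : S.card = l) (hS' : S'.card = l)
            (i : {i // trace pos (A i) v = S}) (i' : {i // trace pos (A i) v' = S'}),
            v = v' → S = S' → emb v S hS i = emb v' S' hS' i' → i.1 = i'.1 := by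
          rintro v _ S _ hS _ i i' rfl rfl e
          exact congrArg Subtype.val ((emb v S hS).injective e)
        have hi : p.1.1 = p'.1.1 := hE' _ _ _ _ _ _ _ _ hV hTT' hE
        have hr : row p = row p' := by
          refine hrow_eq p _ fun j hj => ?_
          rw [hV]
          exact reroute_of_forall_ne (hTT' ▸ hj)
        refine hne (Subtype.ext (Prod.ext hi (pkt.injective (Prod.ext hr ?_))))
        have h2 : (sub p.1.1 (pkt p.1.2).2).1 = (sub p.1.1 (pkt p'.1.2).2).1 := by
          rw [show (sub p.1.1 (pkt p.1.2).2).1 = _ from hTT', hi]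
        exact (sub p.1.1).injective (Subtype.ext h2)
      · obtain ⟨x, hx, hx'⟩ := not_subset.1 hTT
        refine hknow p' _ x ?_ hx'
        rw [← hV, htrace]
        exact hx)
  refine ⟨S, hS.trans ?_⟩
  have hle : q ^ s ≤ q ^ m := Nat.pow_le_pow_right hq hD.le_cols
  have hcard : Fintype.card {v : Fin m → Y // v ∉ univ.image fun r => D r} = q ^ m - q ^ s := by
    rw [Fintype.card_subtype_compl, Fintype.card_coe, card_image_of_injective _ hrow, card_univ,
      hD.card_rows]
    simp [hD.card_points]
  rw [Fintype.card_prod, hcard, Fintype.card_fin]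
  push_cast [Nat.cast_sub hle]
  rfl

/-! ### Counting blocks -/

open Finset in
/-- The number of blocks of the design through an `l`-set of points from distinct groups, by
counting the pairs of such a block and a `(t - l)`-subset of the rest of the block: each extension
of the `l`-set to `t` points from distinct groups lies in one block. -/
theorem card_blocks_superset_mul {X I Y : Type*} [Fintype X] [DecidableEq X] [Fintype I]
    [Fintype Y] [DecidableEq Y] {t m q k l : ℕ} (pos : X ≃ Fin m × Y) (A : I → Finset X)
    (hY : Fintype.card Y = q) (hA : ∀ i, (A i).card = k)
    (hpos : ∀ i, Set.InjOn (fun x => (pos x).1) (A i))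
    (hbal : ∀ T : Finset X, T.card = t → Set.InjOn (fun x => (pos x).1) T →
      (univ.filter fun i => T ⊆ A i).card = 1)
    (hl : l ≤ t) {S : Finset X} (hS : S.card = l) (hSpos : Set.InjOn (fun x => (pos x).1) S) :
    (univ.filter fun i => S ⊆ A i).card * (k - l).choose (t - l) =
      (m - l).choose (t - l) * q ^ (t - l) := by
  classical
  let f : X → Fin m := fun x => (pos x).1
  let Z : Finset X := univ.filter fun x => f x ∉ S.image f
  have hcount := card_transversals f Z (S.image f)ᶜ q (by intro x hx; simpa [Z] using hx)
    (by
      intro j hj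
      rw [← hY, ← card_univ]
      refine card_nbij' (fun x => (pos x).2) (fun y => pos.symm (j, y)) ?_ ?_ ?_ ?_
      · intro x _; simp
      · intro y _
        simp only [coe_filter, Set.mem_ofPred_eq, Z, f, mem_filter, mem_univ, true_and,
          Equiv.apply_symm_apply, and_true]
        exact mem_compl.1 hj
      · intro x hx
        have : f x = j := (mem_filter.1 hx).2
        simp [← this, f]
      · intro y _; simp) (t - l)
  rw [card_compl, Fintype.card_fin, card_image_of_injOn hSpos, hS] at hcount
  rw [← hcount]
  have hdc := sum_card_bipartiteAbove_eq_sum_card_bipartiteBelow (fun i U => U ⊆ A i)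
    (s := univ.filter fun i => S ⊆ A i)
    (t := (Z.powersetCard (t - l)).filter fun U => U.card ≤ (U.image f).card)
  rw [sum_const_nat (m := (k - l).choose (t - l)), sum_const_nat (m := 1), mul_one] at hdc
  · exact hdc
  · intro U hU
    rw [mem_filter, mem_powersetCard] at hU
    obtain ⟨⟨hUZ, hUc⟩, hUi⟩ := hU
    have hUi : Set.InjOn f U := card_image_iff.1 (le_antisymm card_image_le hUi)
    have hne : ∀ x ∈ S, ∀ y ∈ U, f x ≠ f y := by
      intro x hx y hy e
      exact (mem_filter.1 (hUZ hy)).2 (mem_image.2 ⟨x, hx, e⟩)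
    have hdisj : Disjoint S U := disjoint_left.2 fun x hx hx' => hne x hx x hx' rfl
    rw [← hbal (S ∪ U)]
    · congr 1
      ext i
      simp [bipartiteBelow, union_subset_iff]
    · rw [card_union_of_disjoint hdisj, hS, hUc]; omega
    · rw [coe_union, Set.injOn_union (by exact_mod_cast hdisj)]
      exact ⟨hSpos, hUi, fun x hx y hy => hne x hx y hy⟩
  · intro i hi
    have hSi : S ⊆ A i := (mem_filter.1 hi).2
    rw [← hA i, ← hS, ← card_sdiff_of_subset hSi, ← card_powersetCard]
    congr 1
    ext U
    simp only [bipartiteAbove, mem_filter, mem_powersetCard]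
    constructor
    · rintro ⟨⟨⟨hUZ, hUc⟩, -⟩, hUA⟩
      refine ⟨fun x hx => mem_sdiff.2 ⟨hUA hx, fun hxS => ?_⟩, hUc⟩
      exact (mem_filter.1 (hUZ hx)).2 (mem_image_of_mem f hxS)
    · rintro ⟨hUA, hUc⟩
      have hUA' : U ⊆ A i := hUA.trans sdiff_subset
      refine ⟨⟨⟨fun x hx => mem_filter.2 ⟨mem_univ _, fun h => ?_⟩, hUc⟩, ?_⟩, hUA'⟩
      · obtain ⟨y, hy, hyx⟩ := mem_image.1 h
        have := hpos i (hSi hy) (hUA' hx) hyx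
        exact (mem_sdiff.1 (hUA hx)).2 (this ▸ hy)
      · rw [card_image_of_injOn ((hpos i).mono (by exact_mod_cast hUA'))]

open Finset in
/-- At most `(m - l).choose (k - l) * (q - 1) ^ (k - l)` blocks meet the transversal `v` in a given
`l`-set: the rest of such a block takes `k - l` points off `v` from distinct other groups. -/
theorem card_trace_eq_le {X I Y : Type*} [Fintype X] [Finite I]
    [Fintype Y] [DecidableEq Y] {m q k l : ℕ} (pos : X ≃ Fin m × Y) (A : I → Finset X)
    (hinj : Function.Injective A) (hY : Fintype.card Y = q) (hA : ∀ i, (A i).card = k)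
    (hpos : ∀ i, Set.InjOn (fun x => (pos x).1) (A i))
    (v : Fin m → Y) {S : Finset X} (hS : S.card = l) :
    Nat.card {i // trace pos (A i) v = S} ≤ (m - l).choose (k - l) * (q - 1) ^ (k - l) := by
  classical
  have := Fintype.ofFinite I
  rcases isEmpty_or_nonempty {i // trace pos (A i) v = S} with he | ⟨⟨i₀, hi₀⟩⟩
  · simp
  let f : X → Fin m := fun x => (pos x).1
  have hsub : ∀ i, trace pos (A i) v = S → S ⊆ A i := fun i h => h ▸ filter_subset _ _
  have hSpos : Set.InjOn f S := (hpos i₀).mono (by exact_mod_cast hsub i₀ hi₀)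
  let Z : Finset X := univ.filter fun x => f x ∉ S.image f ∧ v (f x) ≠ (pos x).2
  have hcount := card_transversals f Z (S.image f)ᶜ (q - 1)
    (by intro x hx; exact mem_compl.2 (mem_filter.1 hx).2.1)
    (by
      intro j hj
      rw [← hY, ← card_univ, ← card_erase_of_mem (mem_univ (v j))]
      refine card_nbij' (fun x => (pos x).2) (fun y => pos.symm (j, y)) ?_ ?_ ?_ ?_
      · intro x hx
        have h1 := (mem_filter.1 (mem_filter.1 hx).1).2.2
        have h2 : f x = j := (mem_filter.1 hx).2
        rw [h2] at h1
        exact mem_erase.2 ⟨h1.symm, mem_univ _⟩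
      · intro y hy
        have hy' : y ≠ v j := (mem_erase.1 hy).1
        simp only [coe_filter, Set.mem_ofPred_eq, Z, f, mem_filter, mem_univ, true_and,
          Equiv.apply_symm_apply, and_true]
        exact ⟨mem_compl.1 hj, hy'.symm⟩
      · intro x hx
        have : f x = j := (mem_filter.1 hx).2
        simp [← this, f]
      · intro y _; simp) (k - l)
  rw [card_compl, Fintype.card_fin, card_image_of_injOn hSpos, hS] at hcount
  rw [← hcount, Nat.card_eq_fintype_card, Fintype.card_subtype]
  refine card_le_card_of_injOn (fun i => A i \ S) ?_ ?_
  · intro i hi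
    have hi : trace pos (A i) v = S := (mem_filter.1 hi).2
    have hSi := hsub i hi
    refine mem_filter.2 ⟨mem_powersetCard.2 ⟨?_, ?_⟩, ?_⟩
    · intro x hx
      rw [mem_sdiff] at hx
      refine mem_filter.2 ⟨mem_univ _, fun h => ?_, fun h => ?_⟩
      · obtain ⟨y, hy, hyx⟩ := mem_image.1 h
        exact hx.2 (hpos i (hSi hy) hx.1 hyx ▸ hy)
      · exact hx.2 (hi ▸ mem_filter.2 ⟨hx.1, h⟩)
    · rw [card_sdiff_of_subset hSi, hA, hS]
    · rw [card_image_of_injOn ((hpos i).mono (by exact_mod_cast sdiff_subset))]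
  · intro i hi i' hi' h
    have hi : trace pos (A i) v = S := (mem_filter.1 hi).2
    have hi' : trace pos (A i') v = S := (mem_filter.1 hi').2
    dsimp only at h
    apply hinj
    rw [← sdiff_union_of_subset (hsub i hi), h, sdiff_union_of_subset (hsub i' hi')]

/-! ### The load -/

open Finset in
theorem theorem6
    {X I Y R : Type*} [Fintype X] [DecidableEq X] [Fintype I] [DecidableEq I]
    [Fintype Y] [DecidableEq Y] [Fintype R]
    (t m q k s : ℕ) (ht : 1 ≤ t) (htk : t ≤ k) (hks : k ≤ s) (hsm : s < m)
    (G : Finpartition (Finset.univ : Finset X)) (A : I → Finset X)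
    (hGDD : IsGDD t m q k 1 G A)
    (D : Matrix R (Fin m) Y) (hOA : IsOrthogonalArray s q m 1 D) :
    -- the users access distinct sets of cache nodes; their number; the number of cache nodes
    Function.Injective A ∧
    (Fintype.card I : ℚ) = (m.choose t : ℚ) * (q : ℚ) ^ t / (k.choose t : ℚ) ∧
    Fintype.card X = m * q ∧
    ∀ (N : ℕ) (M : ℚ), Fintype.card I ≤ N → M / (N : ℚ) = 1 / (q : ℚ) →
      (N : ℚ) / ((k : ℚ) * (Fintype.card I : ℚ)) ≤ M ∧
      ∀ l : ℕ, 1 ≤ l → l ≤ min (m - s) (t - 1) → ∀ b : ℕ,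
        ∃ S : MADCCScheme A M N (q ^ s * k.choose l) b,
          S.load ≤ (((q : ℚ) ^ m - (q : ℚ) ^ s) * (q : ℚ) ^ (t - l) * ((m - l).choose (t - l) : ℚ))
              / ((q : ℚ) ^ s * (k.choose l : ℚ) * ((k - l).choose (t - l) : ℚ)) ∧
          (k = t → s = m - 1 → l = 1 →
            S.load = ((q : ℚ) - 1) ^ t * ((m - 1).choose (t - 1) : ℚ) / (t : ℚ)) ∧
          (k = t → s = m - t + 1 → t < s → l = m - s →
            S.load = ((q : ℚ) ^ (t - 1) - 1) * ((q : ℚ) - 1) * ((m : ℚ) - (t : ℚ) + 1)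
              / (t : ℚ)) := by
  have hq := hOA.pos_points
  have hY := hOA.card_points
  have hA := hGDD.card_block
  obtain ⟨pos, hG⟩ := G.exists_coordinates (Y := Y) hGDD.card_groups
    fun g hg => (hGDD.card_group g hg).trans hY.symm
  have hpos : ∀ i, Set.InjOn (fun x => (pos x).1) (A i) := fun i =>
    (hG _).1 (hGDD.block_inter i)
  have hbal : ∀ T : Finset X, T.card = t → Set.InjOn (fun x => (pos x).1) T →
      (univ.filter fun i => T ⊆ A i).card = 1 := fun T hT hTi =>
    hGDD.balanced T hT ((hG T).2 hTi)
  have hinj : Function.Injective A := by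
    intro i i' h
    obtain ⟨T, hTA, hT⟩ := exists_subset_card_eq (htk.trans_eq (hA i).symm)
    refine card_le_one.1
      (hbal T hT ((hpos i).mono (by exact_mod_cast hTA))).le i ?_ i' ?_
    · simpa using hTA
    · simpa [← h] using hTA
  have hcardI : Fintype.card I * k.choose t = m.choose t * q ^ t := by
    simpa using card_blocks_superset_mul pos A hY hA hpos hbal (Nat.zero_le t)
      (S := ∅) card_empty (by simp)
  have hkt : 0 < k.choose t := Nat.choose_pos htk
  have htm : t ≤ m := by omega
  have hI : 0 < Fintype.card I := by
    refine Nat.pos_of_mul_pos_right (b := k.choose t) ?_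
    rw [hcardI]
    exact Nat.mul_pos (Nat.choose_pos htm) (pow_pos hq t)
  refine ⟨hinj, ?_, ?_, ?_⟩
  · rw [eq_div_iff (by positivity)]
    exact_mod_cast hcardI
  · rw [Fintype.card_congr pos, Fintype.card_prod, Fintype.card_fin, hY]
  intro N M hN hMN
  have hN0 : 0 < N := hI.trans_le hN
  have hM : M * q = N := by
    rw [div_eq_div_iff (by positivity) (by positivity)] at hMN
    simpa using hMN
  have hqQ : (0 : ℚ) < q := by exact_mod_cast hq
  have hk0 : 0 < k := by omega
  refine ⟨?_, ?_⟩
  · have h1 : q ≤ k * Fintype.card I := by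
      refine Nat.le_of_mul_le_mul_right (c := k.choose t) ?_ hkt
      rw [mul_assoc, hcardI]
      calc q * k.choose t ≤ q ^ t * m.choose t :=
            Nat.mul_le_mul (Nat.le_self_pow (by omega) q) (Nat.choose_le_choose t (by omega))
        _ = 1 * (m.choose t * q ^ t) := by ring
        _ ≤ k * (m.choose t * q ^ t) := Nat.mul_le_mul_right _ hk0
    rw [eq_div_of_mul_eq hqQ.ne' hM]
    gcongr
    exact_mod_cast h1
  intro l hl hlm b
  have hls : l + s ≤ m := by omega
  have hlt : l < t := by omega
  -- the block through the points of `v` in any `t` groups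
  have hsend : ∀ v, ∃ i, l < (trace pos (A i) v).card := by
    intro v
    obtain ⟨J, -, hJ⟩ := exists_subset_card_eq (s := (univ : Finset (Fin m))) (n := t)
      (by simpa using htm)
    have hTi : Function.Injective fun j => pos.symm (j, v j) := fun j j' h =>
      congrArg Prod.fst (pos.symm.injective h)
    obtain ⟨i, hi⟩ := card_pos.1 ((hbal (J.image fun j => pos.symm (j, v j))
      (by rw [card_image_of_injective _ hTi, hJ])
      (by
        intro x hx y hy h
        obtain ⟨j, -, rfl⟩ := mem_image.1 hx
        obtain ⟨j', -, rfl⟩ := mem_image.1 hy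
        simp only [Equiv.apply_symm_apply] at h
        rw [h])).symm ▸ Nat.one_pos)
    refine ⟨i, hlt.trans_le ?_⟩
    rw [← hJ, ← card_image_of_injective J hTi]
    refine card_le_card fun x hx => mem_filter.2 ⟨(mem_filter.1 hi).2 hx, ?_⟩
    obtain ⟨j, -, rfl⟩ := mem_image.1 hx
    simp
  have hkl : 0 < k.choose l := Nat.choose_pos (by omega)
  have hklt : 0 < (k - l).choose (t - l) := Nat.choose_pos (by omega)
  have hqs : (0 : ℚ) ≤ (q : ℚ) ^ m - q ^ s :=
    sub_nonneg.2 (pow_le_pow_right₀ (by exact_mod_cast hq) hsm.le)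
  have hq1 : ((q - 1 : ℕ) : ℚ) = q - 1 := by push_cast [Nat.cast_sub hq]; rfl
  -- for `k = t` the smaller number of messages serves the general bound as well
  by_cases hkt' : k = t
  · subst hkt'
    obtain ⟨S, hS⟩ := exists_scheme_of_card_trace_le (b := b) pos A hA hpos D hOA hl hls
      (fun v S hS => card_trace_eq_le pos A hinj hY hA hpos v hS) hsend hN0 hM
    refine ⟨S, ?_, fun _ hs h1 => ?_, fun _ hs hts h1 => ?_⟩
    · rw [hS, Nat.choose_self]
      push_cast
      rw [hq1, mul_one]
      gcongr ?_ / _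
      rw [mul_assoc, mul_comm ((q : ℚ) ^ (k - l))]
      have : (0 : ℚ) ≤ q - 1 := hq1 ▸ Nat.cast_nonneg _
      gcongr
      linarith
    · subst h1
      rw [hS, Nat.choose_one_right]
      push_cast
      rw [hq1]
      obtain ⟨m, rfl⟩ : ∃ n, m = n + 1 := ⟨m - 1, by omega⟩
      obtain ⟨k, rfl⟩ : ∃ n, k = n + 1 := ⟨k - 1, by omega⟩
      obtain rfl : s = m := by omega
      simp only [Nat.add_sub_cancel]
      push_cast
      field_simp
      ring
    · obtain ⟨j, rfl⟩ : ∃ j, k = j + 1 := ⟨k - 1, by omega⟩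
      obtain rfl : l = j := by omega
      obtain ⟨n, rfl⟩ : ∃ n, m = n + l := ⟨m - l, by omega⟩
      obtain rfl : s = n := by omega
      rw [hS]
      simp only [Nat.add_sub_cancel, Nat.add_sub_cancel_left, Nat.choose_one_right, pow_one,
        Nat.choose_succ_self_right]
      push_cast
      rw [hq1, pow_add]
      field_simp
      ring
  · obtain ⟨ν, hν⟩ : ∃ ν : ℕ, ν * (k - l).choose (t - l) = (m - l).choose (t - l) * q ^ (t - l) ∧
        ∀ v (S : Finset X), S.card = l → Nat.card {i // trace pos (A i) v = S} ≤ ν := by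
      have hsup : ∀ i (S : Finset X), S ⊆ A i → S.card = l →
          (univ.filter fun i => S ⊆ A i).card * (k - l).choose (t - l) =
            (m - l).choose (t - l) * q ^ (t - l) := fun i S hSi hS =>
        card_blocks_superset_mul pos A hY hA hpos hbal hlt.le hS
          ((hpos i).mono (by exact_mod_cast hSi))
      obtain ⟨i₀⟩ := Fintype.card_pos_iff.1 hI
      obtain ⟨S₀, hS₀, hS₀l⟩ := exists_subset_card_eq (s := A i₀) (n := l) (by rw [hA]; omega)
      refine ⟨_, hsup i₀ S₀ hS₀ hS₀l, fun v S hS => ?_⟩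
      rw [Nat.card_eq_fintype_card, Fintype.card_subtype]
      rcases (univ.filter fun i => trace pos (A i) v = S).eq_empty_or_nonempty with h | ⟨i, hi⟩
      · simp [h]
      · have hsub : ∀ i, trace pos (A i) v = S → S ⊆ A i := fun i h => h ▸ filter_subset _ _
        refine (card_le_card (monotone_filter_right univ fun i _ => hsub i)).trans_eq
          (Nat.eq_of_mul_eq_mul_right hklt ?_)
        rw [hsup i S (hsub i (mem_filter.1 hi).2) hS, hsup i₀ S₀ hS₀ hS₀l]
    obtain ⟨S, hS⟩ := exists_scheme_of_card_trace_le (b := b) pos A hA hpos D hOA hl hls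
      hν.2 hsend hN0 hM
    refine ⟨S, ?_, fun h => absurd h hkt', fun h => absurd h hkt'⟩
    have h1 : (ν : ℚ) * (k - l).choose (t - l) = (m - l).choose (t - l) * q ^ (t - l) := by
      exact_mod_cast hν.1
    rw [hS, mul_assoc _ ((q : ℚ) ^ (t - l)), mul_comm ((q : ℚ) ^ (t - l)), ← h1, ← mul_assoc,
      mul_div_mul_right _ _ (by positivity)]
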